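/- Let $J\ge 1$ and consider a tandem line of $J$ stations with finite buffers $B_1,\dots,B_J\in\mathbb Z_+$ and exponential service rates $\mu_1,\dots,\mu_J>0$. Customers arrive at station $1$ in a Poisson stream of rate $\lambda\in(0,\infty)$ with i.i.d. reservation prices with distribution function $F$; write $F(a-)$ for its left limit at $a$. Prices are quoted from a set $\mathcal A\subset[0,\infty)$ such that $1-F(a-)>0$ for all $a\in\mathcal A$ and such that $\max\{a\lambda(1-F(a-)):a\in\mathcal A\}$ exists (for instance, $\mathcal A$ finite and non-empty). The state space is $\mathcal S=\prod_{j=1}^J\{0,1,\dots,B_j+1\}$, where $s_j$ is the number of jobs at station $j$, and a pricing policy is a function $\pi:\mathcal S\to\mathcal A$. Under $\pi$ the state is a continuous-time Markov chain $(\mathbf X^\pi(t))_{t\ge0}$ on $\mathcal S$ with right-continuous paths, whose transition rates between states of $\mathcal S$ are $\lambda(1-F(\pi(\mathbf s)-))$ from $\mathbf s$ to $\mathbf s+\mathbf e_1$, $\mu_j$ from $\mathbf s$ to $\mathbf s-\mathbf e_j+\mathbf e_{j+1}$ ($1\le j<J$), $\mu_J$ from $\mathbf s$ to $\mathbf s-\mathbf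 e_J$, and $0$ otherwise. Let $T_0^\pi=0$, $T_{n+1}^\pi=\inf\{t>T_n^\pi:\mathbf X^\pi(t)\ne\mathbf X^\pi(t-)\}$, and let $R^\pi(\mathbf s,\mathbf s')=\pi(\mathbf s)$ if $\mathbf s'=\mathbf s+\mathbf e_1$ and $R^\pi(\mathbf s,\mathbf s')=0$ otherwise. Then for every pricing policy $\pi$ the gain (long-run expected time-average revenue) $$g^\pi=\lim_{T\to\infty}\frac1T\,\mathbb E\Big[\sum_{n\ge1:\,T^\pi_n\le T}R^\pi\big(\mathbf X^\pi(T^\pi_{n-1}),\mathbf X^\pi(T^\pi_n)\big)\Big]$$ is well defined (the expectations are finite, and the limit exists, is finite and is the same for every initial state), and $$g^\pi\ \le\ \max\{a\lambda(1-F(a-)):a\in\mathcal A\}.$$ Consequently the optimal gain $\sup_\pi g^\pi$ (a maximum if $\mathcal A$ is finite) is also at most $\max\{a\lambda(1-F(a-)):a\in\mathcal A\}$. -/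

import Mathlib

open MeasureTheory ProbabilityTheory Filter Topology
open scoped NNReal ENNReal

noncomputable section

/-! ### Continuous-time Markov chains on a finite state space -/

/-- A conservative generator (Q-matrix) on a finite set `S`. -/
structure Generator (S : Type) [Fintype S] where
  Q : S → S → ℝ
  nonneg : ∀ s s', s ≠ s' → 0 ≤ Q s s'
  sum_zero : ∀ s, ∑ s', Q s s' = 0

namespace Generator

variable {S : Type} [Fintype S]

/-- The total rate at which the chain leaves the state `s`. -/
def exitRate (G : Generator S) (s : S) : ℝ := -G.Q s s

variable [DecidableEq S]

theorem sum_erase (G : Generator S) (s : S) :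
    ∑ s' ∈ Finset.univ.erase s, G.Q s s' = G.exitRate s := by
  have h := Finset.add_sum_erase Finset.univ (G.Q s) (Finset.mem_univ s)
  rw [G.sum_zero s] at h
  unfold exitRate
  linarith

variable [MeasurableSpace S]

/-- The law of the state after the next jump out of `s`: it is `s'` with probability
`Q s s' / exitRate s`. An absorbing state is never left. -/
def jumpLaw (G : Generator S) (s : S) : Measure S :=
  if 0 < G.exitRate s then
    ∑ s' ∈ Finset.univ.erase s, ENNReal.ofReal (G.Q s s' / G.exitRate s) • Measure.dirac s'
  else Measure.dirac s

/-- The law of the time spent in `s`: exponential with rate `exitRate s`. In an absorbing state,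
where the jump law leads back to `s`, the duration of a stage is irrelevant and set to `1`. -/
def holdLaw (G : Generator S) (s : S) : Measure ℝ :=
  if 0 < G.exitRate s then expMeasure (G.exitRate s) else Measure.dirac 1

instance isProbabilityMeasure_jumpLaw (G : Generator S) (s : S) :
    IsProbabilityMeasure (G.jumpLaw s) := by
  unfold jumpLaw
  split_ifs with h
  · constructor
    have h1 : ∀ s' ∈ Finset.univ.erase s, 0 ≤ G.Q s s' / G.exitRate s := fun s' hs' =>
      div_nonneg (G.nonneg s s' (Finset.ne_of_mem_erase hs').symm) h.le
    simp only [Measure.coe_finsetSum, Finset.sum_apply, Measure.smul_apply, measure_univ,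
      smul_eq_mul, mul_one]
    rw [← ENNReal.ofReal_sum_of_nonneg h1, ← Finset.sum_div, G.sum_erase, div_self h.ne',
      ENNReal.ofReal_one]
  · infer_instance

instance isProbabilityMeasure_holdLaw (G : Generator S) (s : S) :
    IsProbabilityMeasure (G.holdLaw s) := by
  unfold holdLaw
  split_ifs with h
  · exact isProbabilityMeasure_expMeasure h
  · infer_instance

variable [DiscreteMeasurableSpace S]

/-- The law of a stage of the chain in state `s`: the state together with its holding time. -/
def stageKernel (G : Generator S) : Kernel S (S × ℝ) where
  toFun s := (Measure.dirac s).prod (G.holdLaw s)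
  measurable' := Measurable.of_discrete

instance (G : Generator S) : IsMarkovKernel G.stageKernel :=
  ⟨fun s => inferInstanceAs (IsProbabilityMeasure ((Measure.dirac s).prod (G.holdLaw s)))⟩

def jumpKernel (G : Generator S) : Kernel S S where
  toFun := G.jumpLaw
  measurable' := Measurable.of_discrete

instance (G : Generator S) : IsMarkovKernel G.jumpKernel :=
  ⟨fun s => G.isProbabilityMeasure_jumpLaw s⟩

/-- The law of stage `n + 1` given the stages `0, …, n`; it depends on the state of
stage `n` only. -/
def step (G : Generator S) (n : ℕ) : Kernel ((_ : Finset.Iic n) → S × ℝ) (S × ℝ) :=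
  (G.stageKernel ∘ₖ G.jumpKernel).comap
    (fun h => (h ⟨n, Finset.mem_Iic.2 le_rfl⟩).1)
    (measurable_fst.comp (measurable_pi_apply _))

instance (G : Generator S) (n : ℕ) : IsMarkovKernel (G.step n) := by
  unfold step
  infer_instance

/-- The law, on sequences of stages (state, holding time), of the continuous-time Markov chain
with generator `G` started in `s₀`. -/
def law (G : Generator S) (s₀ : S) : Measure (ℕ → S × ℝ) :=
  Kernel.trajMeasure (X := fun _ => S × ℝ) (G.stageKernel s₀) G.step

end Generator

/-- The state at time `t` of the right-continuous path that visits the states `(ω n).1` in turn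
and stays for the time `(ω n).2` in the `n`-th of them. -/
def chainAt {S : Type} (ω : ℕ → S × ℝ) (t : ℝ≥0) : S :=
  (ω (sInf {n : ℕ | (t : ℝ) < ∑ k ∈ Finset.range (n + 1), (ω k).2})).1

/-- `x (t-) ≠ x t`, for a path in a discrete space. -/
def ChangesAt {S : Type} (x : ℝ≥0 → S) (t : ℝ≥0) : Prop :=
  ¬ ∀ᶠ u in 𝓝[<] t, x u = x t

/-- The successive times at which a path changes, `T₀ = 0` and
`Tₙ₊₁ = inf {t > Tₙ : x (t-) ≠ x t}`, with value `∞` if there is no further change. -/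
def changeTime {S : Type} (x : ℝ≥0 → S) : ℕ → ℝ≥0∞
  | 0 => 0
  | n + 1 => sInf ((fun t : ℝ≥0 => (t : ℝ≥0∞)) '' {t | changeTime x n < t ∧ ChangesAt x t})

/-- The total reward `∑ R (x (Tₙ₋₁)) (x (Tₙ))` over all `n ≥ 1` with `Tₙ ≤ T`, for a non-negative
reward function `R` on transitions. -/
def totalReward {S : Type} (R : S → S → ℝ) (x : ℝ≥0 → S) (T : ℝ≥0) : ℝ≥0∞ :=
  open Classical in
  ∑' n : ℕ, if changeTime x (n + 1) ≤ T then
    ENNReal.ofReal (R (x (changeTime x n).toNNReal) (x (changeTime x (n + 1)).toNNReal)) else 0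

/-! ### The tandem queueing system -/

/-- A tandem line of `J` stations; stations are numbered `0, …, J - 1`. -/
structure TandemSystem (J : ℕ) where
  /-- buffer sizes, not counting the job in service -/
  B : Fin J → ℕ
  /-- service rates -/
  μ : Fin J → ℝ
  μ_pos : ∀ j, 0 < μ j
  /-- rate of the Poisson stream of incoming customers -/
  lam : ℝ
  lam_pos : 0 < lam
  /-- distribution of the reservation prices -/
  reservation : Measure ℝ
  prob : IsProbabilityMeasure reservation

namespace TandemSystem

variable {J : ℕ} (Θ : TandemSystem J)

/-- States: the number of jobs at station `j` ranges over `0, …, B j + 1`. -/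
abbrev State : Type := (j : Fin J) → Fin (Θ.B j + 2)

/-- `1 - F(a-)`, with `F` the distribution function of the reservation prices. -/
def entryProb (a : ℝ) : ℝ := 1 - Function.leftLim (cdf Θ.reservation) a

/-- The unit vector of station `k`; it is zero for `k = J`. -/
def unitVec (J k : ℕ) : Fin J → ℤ := fun i => if (i : ℕ) = k then 1 else 0

/-- `s' = s + e₀`: a customer enters station `0`. -/
def IsEntry (s s' : Θ.State) : Prop :=
  ∀ i, ((s' i : ℕ) : ℤ) = ((s i : ℕ) : ℤ) + unitVec J 0 i

/-- `s' = s - e_j + e_{j+1}`, which reads `s' = s - e_j` for the last station `j`: a job is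
completed at station `j`. As `s'` is a state, this needs a free place at station `j + 1`. -/
def IsService (j : Fin J) (s s' : Θ.State) : Prop :=
  ∀ i, ((s' i : ℕ) : ℤ) = ((s i : ℕ) : ℤ) - unitVec J j i + unitVec J (j + 1) i

instance (s s' : Θ.State) : Decidable (Θ.IsEntry s s') := by
  unfold IsEntry
  infer_instance

instance (j : Fin J) (s s' : Θ.State) : Decidable (Θ.IsService j s s') := by
  unfold IsService
  infer_instance

variable {A : Set ℝ} (π : Θ.State → A)

/-- The transition rates between different states under the pricing policy `π`. -/
def rate (s s' : Θ.State) : ℝ :=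
  if Θ.IsEntry s s' then Θ.lam * Θ.entryProb (π s)
  else ∑ j, if Θ.IsService j s s' then Θ.μ j else 0

theorem entryProb_nonneg (a : ℝ) : 0 ≤ Θ.entryProb a :=
  sub_nonneg.2 (((monotone_cdf Θ.reservation).leftLim_le le_rfl).trans
    (cdf_le_one Θ.reservation a))

theorem rate_nonneg (s s' : Θ.State) : 0 ≤ Θ.rate π s s' := by
  unfold rate
  split_ifs
  · exact mul_nonneg Θ.lam_pos.le (Θ.entryProb_nonneg _)
  · exact Finset.sum_nonneg fun j _ => by
      split_ifs
      exacts [(Θ.μ_pos j).le, le_rfl]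

/-- The generator `Q^π` of the state process under the policy `π`. -/
def generator : Generator Θ.State where
  Q s s' := if s = s' then -∑ s'' ∈ Finset.univ.erase s, Θ.rate π s s'' else Θ.rate π s s'
  nonneg s s' h := by
    rw [if_neg h]
    exact Θ.rate_nonneg π s s'
  sum_zero s := by
    rw [← Finset.add_sum_erase Finset.univ _ (Finset.mem_univ s), if_pos rfl,
      neg_add_eq_zero]
    exact Finset.sum_congr rfl fun s' h => (if_neg (Finset.ne_of_mem_erase h).symm).symm

/-- The reward function `R^π`: the quoted price is earned when a customer enters. -/
def reward (s s' : Θ.State) : ℝ := if Θ.IsEntry s s' then (π s : ℝ) else 0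

/-- The expected revenue up to time `T` under the policy `π`, from the initial state `s₀`. -/
def expectedRevenue (s₀ : Θ.State) (T : ℝ≥0) : ℝ≥0∞ :=
  ∫⁻ ω, totalReward (Θ.reward π) (chainAt ω) T ∂((Θ.generator π).law s₀)

/-- `g` is the gain of the policy `π`: from every initial state the expected revenue up to any
time is finite, and the expected time-average revenue converges to `g`. -/
def IsGain (g : ℝ) : Prop :=
  ∀ s₀ : Θ.State, (∀ T, Θ.expectedRevenue π s₀ T ≠ ∞) ∧
    Tendsto (fun T : ℝ≥0 => (Θ.expectedRevenue π s₀ T).toReal / (T : ℝ)) atTop (𝓝 g)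

end TandemSystem

end

/-! Write `Q` for the generator and `ρ s = ∑ Q s s' * R s s'` for the rate at which revenue is
earned in state `s`. At most one transition out of `s` is an entry, so `ρ s` is either `0` or `a *
lam * entryProb a` with `a = π s`; in both cases `ρ ≤ M`. If `ρ + Q h = g` with a constant `g`, then
at a maximum of `h` the term `Q h` is nonpositive, hence `g ≤ M`. No stationary distribution is
needed.

The equation is solvable (`exists_poisson`) because the empty line can be reached from every state
by services alone: the maximum principle makes a square linear system injective, hence surjective.

That `g` is the gain is a martingale argument in discrete form. If stage `n` begins at `τ ≤ T` in
state `s`, give it the value `g * (T - τ) + h s`. By `transitionReward_add`, the expected value of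
stage `n` is the expected reward of its final transition, plus the expected value of stage `n + 1`,
plus the part of `h` retained if the state is not left by time `T`. Summed over `n`, the retained
parts amount to at most `max h`, so the expected revenue differs from `g * T` by a bounded amount,
whatever the initial state.

Almost surely durations are positive, successive states differ and stages do not accumulate. Hence
the change times of the path are exactly the stage boundaries (`changeTime_chainAt`), and the
revenue is a sum over stages. -/

noncomputable section

/-- The time at which stage `n` begins. -/
def stageStart {S : Type} (ω : ℕ → S × ℝ) (n : ℕ) : ℝ := ∑ k ∈ Finset.range n, (ω k).2

theorem stageStart_zero {S : Type} (ω : ℕ → S × ℝ) : stageStart ω 0 = 0 := by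
  simp [stageStart]

theorem stageStart_succ {S : Type} (ω : ℕ → S × ℝ) (n : ℕ) :
    stageStart ω (n + 1) = stageStart ω n + (ω n).2 :=
  Finset.sum_range_succ _ _

@[fun_prop]
theorem measurable_stageStart {S : Type} [MeasurableSpace S] (n : ℕ) :
    Measurable fun ω : ℕ → S × ℝ => stageStart ω n := by
  unfold stageStart
  fun_prop

/-! ### Markov property of the sequence of stages -/

namespace Generator

variable {S : Type} [Fintype S] [MeasurableSpace S] [DiscreteMeasurableSpace S]

theorem lintegral_stageKernel (G : Generator S) (s : S) {f : S × ℝ → ℝ≥0∞} (hf : Measurable f) :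
    ∫⁻ x, f x ∂G.stageKernel s = ∫⁻ u, f (s, u) ∂G.holdLaw s := by
  change ∫⁻ x, f x ∂((Measure.dirac s).prod (G.holdLaw s)) = _
  rw [lintegral_prod _ hf.aemeasurable, lintegral_dirac]

variable [DecidableEq S]

instance isProbabilityMeasure_law (G : Generator S) (s₀ : S) :
    IsProbabilityMeasure (G.law s₀) := by
  unfold law
  infer_instance

theorem lintegral_jumpLaw (G : Generator S) {s : S} (hs : 0 < G.exitRate s) (f : S → ℝ≥0∞) :
    ∫⁻ x, f x ∂G.jumpLaw s =
      ∑ s' ∈ Finset.univ.erase s, ENNReal.ofReal (G.Q s s' / G.exitRate s) * f s' := by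
  unfold jumpLaw
  rw [if_pos hs]
  simp [lintegral_finsetSum_measure, lintegral_smul_measure]

/-- The state and the duration of stage `0`. -/
theorem lintegral_law_zero (G : Generator S) (s₀ : S) {f : S × ℝ → ℝ≥0∞} (hf : Measurable f) :
    ∫⁻ ω, f (ω 0) ∂G.law s₀ = ∫⁻ u, f (s₀, u) ∂G.holdLaw s₀ := by
  have h : (G.law s₀).map (fun ω => ω 0) = G.stageKernel s₀ := by
    unfold law Kernel.trajMeasure
    have e : (fun ω : ℕ → S × ℝ => ω 0) =
        (fun x => x ⟨0, Finset.mem_Iic.2 le_rfl⟩) ∘ Preorder.frestrictLe (π := fun _ => S × ℝ) 0 :=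
      rfl
    rw [e, ← Measure.map_map (by fun_prop) (by fun_prop), Measure.map_comp _ _ (by fun_prop),
      Kernel.traj_map_frestrictLe, Kernel.partialTraj_self, Measure.id_comp,
      Measure.map_map (by fun_prop) (by fun_prop)]
    exact Measure.map_id
  rw [← lintegral_map hf (measurable_pi_apply 0), h, G.lintegral_stageKernel s₀ hf]

/-- The Markov property: stage `n + 1` given the stages up to `n`. -/
theorem lintegral_law_succ (G : Generator S) (s₀ : S) (n : ℕ) {f : ℝ → S → S → ℝ → ℝ≥0∞}
    (hf : Measurable fun p : ℝ × S × S × ℝ => f p.1 p.2.1 p.2.2.1 p.2.2.2) :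
    ∫⁻ ω, f (stageStart ω (n + 1)) (ω n).1 (ω (n + 1)).1 (ω (n + 1)).2 ∂G.law s₀ =
      ∫⁻ ω, ∫⁻ s', ∫⁻ u, f (stageStart ω (n + 1)) (ω n).1 s' u ∂G.holdLaw s' ∂G.jumpLaw (ω n).1
        ∂G.law s₀ := by
  have key := Kernel.map_frestrictLe_trajMeasure_compProd_eq_map_trajMeasure
    (X := fun _ => S × ℝ) (μ₀ := G.stageKernel s₀) (κ := G.step) (a := n)
  change (G.law s₀).map _ ⊗ₘ _ = (G.law s₀).map _ at key
  -- The integrand depends on the history only through its total duration and its last state, and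
  -- the step kernel only through the last state.
  let τ : ((_ : Finset.Iic n) → S × ℝ) → ℝ := fun h => ∑ k, (h k).2
  have hτ : ∀ ω : ℕ → S × ℝ, τ (Preorder.frestrictLe (π := fun _ => S × ℝ) n ω) =
      stageStart ω (n + 1) := by
    intro ω
    simp only [τ, stageStart, Preorder.frestrictLe_apply]
    rw [Finset.sum_coe_sort (Finset.Iic n) fun k => (ω k).2, Nat.range_succ_eq_Iic]
  let last : ((_ : Finset.Iic n) → S × ℝ) → S := fun h => (h ⟨n, Finset.mem_Iic.2 le_rfl⟩).1
  have hτm : Measurable τ := by fun_prop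
  have hlast : Measurable last := by fun_prop
  let F : ((_ : Finset.Iic n) → S × ℝ) × (S × ℝ) → ℝ≥0∞ :=
    fun p => f (τ p.1) (last p.1) p.2.1 p.2.2
  have hF : Measurable F := hf.comp (by fun_prop :
    Measurable fun p : ((_ : Finset.Iic n) → S × ℝ) × (S × ℝ) => (τ p.1, last p.1, p.2.1, p.2.2))
  have h1 : ∫⁻ ω, f (stageStart ω (n + 1)) (ω n).1 (ω (n + 1)).1 (ω (n + 1)).2 ∂G.law s₀ =
      ∫⁻ p, F p ∂((G.law s₀).map fun ω =>
        (Preorder.frestrictLe (π := fun _ => S × ℝ) n ω, ω (n + 1))) := by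
    rw [lintegral_map hF (by fun_prop)]
    refine lintegral_congr fun ω => ?_
    simp only [F, hτ]
    rfl
  rw [h1, ← key, Measure.lintegral_compProd hF,
    lintegral_map (hF.lintegral_kernel_prod_right') (by fun_prop)]
  refine lintegral_congr fun ω => ?_
  have hF' : Measurable fun b : S × ℝ => F (Preorder.frestrictLe (π := fun _ => S × ℝ) n ω, b) :=
    hF.comp (by fun_prop)
  unfold step
  rw [Kernel.comap_apply, Kernel.lintegral_comp _ _ _ hF']
  refine lintegral_congr fun s' => ?_
  rw [lintegral_stageKernel _ _ hF']
  simp only [F, hτ]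
  rfl

/-- Given its state, the duration of stage `n` is independent of the time at which it begins. -/
theorem lintegral_law_hold (G : Generator S) (s₀ : S) (n : ℕ) {f : ℝ → S → ℝ → ℝ≥0∞}
    (hf : Measurable fun p : ℝ × S × ℝ => f p.1 p.2.1 p.2.2) :
    ∫⁻ ω, f (stageStart ω n) (ω n).1 (ω n).2 ∂G.law s₀ =
      ∫⁻ ω, ∫⁻ u, f (stageStart ω n) (ω n).1 u ∂G.holdLaw (ω n).1 ∂G.law s₀ := by
  have hH : Measurable fun p : ℝ × S => ∫⁻ u, f p.1 p.2 u ∂G.holdLaw p.2 := by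
    refine measurable_from_prod_countable_left fun s => ?_
    refine Measurable.lintegral_prod_right' (ν := G.holdLaw s) (f := fun q : ℝ × ℝ => f q.1 s q.2) ?_
    exact hf.comp (by fun_prop : Measurable fun q : ℝ × ℝ => (q.1, s, q.2))
  cases n with
  | zero =>
    simp only [stageStart_zero]
    rw [G.lintegral_law_zero s₀ (f := fun x => f 0 x.1 x.2) (hf.comp (by fun_prop :
        Measurable fun x : S × ℝ => ((0 : ℝ), x.1, x.2))),
      G.lintegral_law_zero s₀ (f := fun x => ∫⁻ u, f 0 x.1 u ∂G.holdLaw x.1) (hH.comp (by fun_prop :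
        Measurable fun x : S × ℝ => ((0 : ℝ), x.1)))]
    simp
  | succ n =>
    -- The Markov property applied to both sides gives the same integral: on the right the inner
    -- integrand no longer depends on the duration, and `holdLaw` has mass one.
    rw [G.lintegral_law_succ s₀ n (f := fun t _ s' u => f t s' u) (hf.comp (by fun_prop :
        Measurable fun p : ℝ × S × S × ℝ => (p.1, p.2.2.1, p.2.2.2))),
      G.lintegral_law_succ s₀ n (f := fun t _ s' _ => ∫⁻ u, f t s' u ∂G.holdLaw s')
        (hH.comp (by fun_prop : Measurable fun p : ℝ × S × S × ℝ => (p.1, p.2.2.1)))]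
    simp

/-- The transition from stage `n` to stage `n + 1`, given the stages before `n` and the state of
stage `n`. -/
theorem lintegral_law_transition (G : Generator S) (s₀ : S) (n : ℕ) {f : ℝ → S → S → ℝ≥0∞}
    (hf : Measurable fun p : ℝ × S × S => f p.1 p.2.1 p.2.2) :
    ∫⁻ ω, f (stageStart ω (n + 1)) (ω n).1 (ω (n + 1)).1 ∂G.law s₀ =
      ∫⁻ ω, ∫⁻ u, ∫⁻ s', f (stageStart ω n + u) (ω n).1 s' ∂G.jumpLaw (ω n).1
        ∂G.holdLaw (ω n).1 ∂G.law s₀ := by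
  have hJ : Measurable fun p : ℝ × S => ∫⁻ s', f p.1 p.2 s' ∂G.jumpLaw p.2 := by
    refine measurable_from_prod_countable_left fun s => ?_
    refine Measurable.lintegral_prod_right' (ν := G.jumpLaw s) (f := fun q : ℝ × S => f q.1 s q.2) ?_
    exact hf.comp (by fun_prop : Measurable fun q : ℝ × S => (q.1, s, q.2))
  rw [G.lintegral_law_succ s₀ n (f := fun t s s' _ => f t s s') (hf.comp (by fun_prop :
        Measurable fun p : ℝ × S × S × ℝ => (p.1, p.2.1, p.2.2.1)))]
  simp only [lintegral_const, measure_univ, mul_one, stageStart_succ]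
  exact G.lintegral_law_hold s₀ n (f := fun t s u => ∫⁻ s', f (t + u) s s' ∂G.jumpLaw s)
    (hJ.comp (by fun_prop : Measurable fun p : ℝ × S × ℝ => (p.1 + p.2.2, p.2.1)))

theorem ae_state_zero (G : Generator S) (s₀ : S) : ∀ᵐ ω ∂G.law s₀, (ω 0).1 = s₀ := by
  have hm : MeasurableSet {x : S × ℝ | ¬ x.1 = s₀} :=
    (measurable_fst (Set.toFinite {s₀}).measurableSet).compl
  have h := G.lintegral_law_zero s₀ (f := {x : S × ℝ | ¬ x.1 = s₀}.indicator 1)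
    (measurable_one.indicator hm)
  have hm' : MeasurableSet {ω : ℕ → S × ℝ | ¬ (ω 0).1 = s₀} :=
    (by fun_prop : Measurable fun ω : ℕ → S × ℝ => ω 0) hm
  rw [ae_iff, ← lintegral_indicator_one hm']
  exact h.trans (by simp)

/-- Exponential laws do not charge the nonpositive reals, and the default duration in an absorbing
state is `1`. -/
theorem ae_hold_pos (G : Generator S) (s₀ : S) : ∀ᵐ ω ∂G.law s₀, ∀ n, 0 < (ω n).2 := by
  rw [ae_all_iff]
  intro n
  have hm : MeasurableSet {x : ℝ | ¬ 0 < x} := (measurableSet_lt measurable_const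
    measurable_id).compl
  have h := G.lintegral_law_hold s₀ n (f := fun _ _ => {x : ℝ | ¬ 0 < x}.indicator 1)
    ((measurable_one.indicator hm).comp (by fun_prop :
      Measurable fun p : ℝ × S × ℝ => p.2.2))
  have h0 : ∀ s, ∫⁻ u, {x : ℝ | ¬ 0 < x}.indicator 1 u ∂G.holdLaw s = 0 := by
    intro s
    rw [lintegral_indicator_one hm]
    unfold holdLaw
    split_ifs with hs
    · have e : {x : ℝ | ¬ 0 < x} = Set.Iic 0 := by ext; simp
      unfold expMeasure gammaMeasure
      rw [e, withDensity_apply _ measurableSet_Iic, setLIntegral_congr Iio_ae_eq_Iic.symm]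
      rw [lintegral_gammaPDF_of_nonpos le_rfl]
    · rw [Measure.dirac_apply' _ hm]
      simp
  simp only [h0, lintegral_zero] at h
  have hm' : MeasurableSet {ω : ℕ → S × ℝ | ¬ 0 < (ω n).2} :=
    (measurable_snd.comp (measurable_pi_apply n)) hm
  rw [ae_iff, ← lintegral_indicator_one hm']
  exact h

theorem ae_state_ne (G : Generator S) (hG : ∀ s, 0 < G.exitRate s) (s₀ : S) :
    ∀ᵐ ω ∂G.law s₀, ∀ n, (ω (n + 1)).1 ≠ (ω n).1 := by
  rw [ae_all_iff]
  intro n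
  have h := G.lintegral_law_transition s₀ n (f := fun _ s s' => if s' = s then 1 else 0)
    ((Measurable.of_discrete (f := fun p : S × S => if p.2 = p.1 then (1 : ℝ≥0∞) else 0)).comp
      measurable_snd)
  have h0 : ∀ s, ∫⁻ s', (if s' = s then 1 else 0) ∂G.jumpLaw s = 0 := by
    intro s
    rw [G.lintegral_jumpLaw (hG s)]
    refine Finset.sum_eq_zero fun s' hs' => ?_
    rw [if_neg (Finset.ne_of_mem_erase hs'), mul_zero]
  simp only [h0, lintegral_zero] at h
  have hm : MeasurableSet {p : S × S | p.2 = p.1} := (Set.toFinite _).measurableSet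
  have hm' : MeasurableSet {ω : ℕ → S × ℝ | ¬ (ω (n + 1)).1 ≠ (ω n).1} := by
    simp only [not_not]
    exact (by fun_prop : Measurable fun ω : ℕ → S × ℝ => ((ω n).1, (ω (n + 1)).1)) hm
  rw [ae_iff, ← lintegral_indicator_one hm', ← h]
  refine lintegral_congr fun ω => ?_
  simp [Set.indicator_apply]

end Generator

/-! ### Integrals against the exponential law -/

theorem measurable_gammaPDF (a r : ℝ) : Measurable (gammaPDF a r) :=
  (measurable_gammaPDFReal a r).ennreal_ofReal

theorem lintegral_expMeasure_of_neg {q t : ℝ} (ht : t < 0) (f : ℝ → ℝ≥0∞) (hf : Measurable f) :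
    ∫⁻ u, (if u ≤ t then f u else 0) ∂expMeasure q = 0 := by
  have hm : Measurable fun u : ℝ => if u ≤ t then f u else 0 :=
    Measurable.ite measurableSet_Iic hf measurable_const
  unfold expMeasure gammaMeasure
  rw [lintegral_withDensity_eq_lintegral_mul _ (measurable_gammaPDF 1 q) hm,
    lintegral_eq_zero_iff ((measurable_gammaPDF 1 q).mul hm)]
  refine ae_of_all _ fun u => ?_
  by_cases hu : u ≤ t
  · simp [gammaPDF_of_neg (hu.trans_lt ht)]
  · simp [hu]

/-- The integrand times the density has the antiderivative `-exp (-(q * u)) * (h + g * (t - u))`.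
The summand `g / q + h` is the mean of reward plus next bias over one jump, by the bias equation
divided by the exit rate `q`. -/
theorem lintegral_expMeasure_affine {q t g h : ℝ} (hq : 0 < q) (ht : 0 ≤ t) (hg : 0 ≤ g)
    (hh : 0 ≤ h) :
    ∫⁻ u, (if u ≤ t then ENNReal.ofReal (g / q + h + g * (t - u)) else 0) ∂expMeasure q =
      ENNReal.ofReal (g * t + h - Real.exp (-(q * t)) * h) := by
  have hm : Measurable fun u : ℝ =>
      if u ≤ t then ENNReal.ofReal (g / q + h + g * (t - u)) else 0 :=
    Measurable.ite measurableSet_Iic (by fun_prop) measurable_const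
  have hderiv : ∀ u ∈ Set.uIcc 0 t, HasDerivAt
      (fun u => -(Real.exp (-(q * u)) * (h + g * (t - u))))
      (q * Real.exp (-(q * u)) * (g / q + h + g * (t - u))) u := by
    intro u _
    have h1 : HasDerivAt (fun u => Real.exp (-(q * u))) (Real.exp (-(q * u)) * (-(q * 1))) u :=
      ((hasDerivAt_id u).const_mul q).neg.exp
    have h2 : HasDerivAt (fun u => h + g * (t - u)) (g * (0 - 1)) u :=
      (((hasDerivAt_const u t).sub (hasDerivAt_id u)).const_mul g).const_add h
    convert! (h1.mul h2).neg using 1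
    field_simp
    ring
  have hcont : Continuous fun u => q * Real.exp (-(q * u)) * (g / q + h + g * (t - u)) := by
    fun_prop
  have hint := intervalIntegral.integral_eq_sub_of_hasDerivAt hderiv
    (hcont.intervalIntegrable 0 t)
  rw [intervalIntegral.integral_of_le ht] at hint
  unfold expMeasure gammaMeasure
  rw [lintegral_withDensity_eq_lintegral_mul _ (measurable_gammaPDF 1 q) hm]
  have e : ∀ u, (gammaPDF 1 q * fun u : ℝ =>
      if u ≤ t then ENNReal.ofReal (g / q + h + g * (t - u)) else 0) u =
      (Set.Icc 0 t).indicator (fun u => ENNReal.ofReal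
        (q * Real.exp (-(q * u)) * (g / q + h + g * (t - u)))) u := by
    intro u
    rw [Pi.mul_apply]
    change exponentialPDF q u * _ = _
    by_cases h0 : 0 ≤ u
    · by_cases h1 : u ≤ t
      · rw [exponentialPDF_of_nonneg h0, if_pos h1, Set.indicator_of_mem (Set.mem_Icc.2 ⟨h0, h1⟩),
          ← ENNReal.ofReal_mul (by positivity)]
      · rw [if_neg h1, mul_zero, Set.indicator_of_notMem fun h => h1 h.2]
    · rw [exponentialPDF_of_neg (not_le.1 h0), zero_mul,
        Set.indicator_of_notMem fun h => h0 h.1]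
  rw [lintegral_congr e, lintegral_indicator measurableSet_Icc,
    setLIntegral_congr Ioc_ae_eq_Icc.symm, ← ofReal_integral_eq_lintegral_ofReal, hint]
  · congr 1
    simp
    ring
  · exact (hcont.integrableOn_Icc (a := 0) (b := t)).mono_set Set.Ioc_subset_Icc_self
  · refine (ae_restrict_iff' measurableSet_Ioc).2 (ae_of_all _ fun u hu => ?_)
    have : 0 ≤ t - u := sub_nonneg.2 hu.2
    simp only [Pi.zero_apply]
    positivity

theorem measurable_stage_integrand {S : Type} [Countable S] [MeasurableSpace S]
    [DiscreteMeasurableSpace S] {T : ℝ} {f : S → ℝ → ℝ} (hf : ∀ s, Measurable (f s)) (n : ℕ) :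
    Measurable fun ω : ℕ → S × ℝ =>
      if stageStart ω n ≤ T then ENNReal.ofReal (f (ω n).1 (T - stageStart ω n)) else 0 := by
  refine Measurable.ite (measurableSet_le (measurable_stageStart n) measurable_const) ?_
    measurable_const
  have h : Measurable fun p : ℝ × S => f p.2 p.1 := measurable_from_prod_countable_left hf
  exact (h.comp (by fun_prop :
    Measurable fun ω : ℕ → S × ℝ => (T - stageStart ω n, (ω n).1))).ennreal_ofReal

theorem measurable_transition_integrand {S : Type} [Countable S] [MeasurableSpace S]
    [DiscreteMeasurableSpace S] (T : ℝ) (R : S → S → ℝ) (n : ℕ) :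
    Measurable fun ω : ℕ → S × ℝ =>
      if stageStart ω (n + 1) ≤ T then ENNReal.ofReal (R (ω n).1 (ω (n + 1)).1) else 0 := by
  refine Measurable.ite (measurableSet_le (measurable_stageStart _) measurable_const) ?_
    measurable_const
  exact ((Measurable.of_discrete (f := fun p : S × S => R p.1 p.2)).comp (by fun_prop :
    Measurable fun ω : ℕ → S × ℝ => ((ω n).1, (ω (n + 1)).1))).ennreal_ofReal

/-! ### Expected rewards in the presence of a bias -/

namespace Generator

variable {S : Type} [Fintype S] [DecidableEq S]

/-- `h` is a relative value function for the reward `R` on transitions, with gain `g`. -/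
def IsBias (G : Generator S) (R : S → S → ℝ) (g : ℝ) (h : S → ℝ) : Prop :=
  ∀ s, ∑ s' ∈ Finset.univ.erase s, G.Q s s' * (R s s' + h s') = g + G.exitRate s * h s

variable [MeasurableSpace S] [DiscreteMeasurableSpace S]

/-- The expectation of `f Y (T - τ)` if stage `n` begins at a time `τ ≤ T`, in the state `Y`. -/
def stageValue (G : Generator S) (s₀ : S) (T : ℝ) (f : S → ℝ → ℝ) (n : ℕ) : ℝ≥0∞ :=
  ∫⁻ ω, (if stageStart ω n ≤ T then ENNReal.ofReal (f (ω n).1 (T - stageStart ω n)) else 0)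
    ∂G.law s₀

/-- The expected reward from the transition that ends stage `n`, if it occurs by time `T`. -/
def transitionReward (G : Generator S) (s₀ : S) (T : ℝ) (R : S → S → ℝ) (n : ℕ) : ℝ≥0∞ :=
  ∫⁻ ω, (if stageStart ω (n + 1) ≤ T then ENNReal.ofReal (R (ω n).1 (ω (n + 1)).1) else 0)
    ∂G.law s₀

theorem lintegral_transition_bias (G : Generator S) {R : S → S → ℝ} (hR : ∀ s s', 0 ≤ R s s')
    {g : ℝ} (hg : 0 ≤ g) {h : S → ℝ} (hh : ∀ s, 0 ≤ h s) (hb : G.IsBias R g h) {s : S}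
    (hs : 0 < G.exitRate s) {t : ℝ} (ht : 0 ≤ t) :
    ∫⁻ u, ∫⁻ s', (if u ≤ t then ENNReal.ofReal (R s s' + (g * (t - u) + h s')) else 0)
        ∂G.jumpLaw s ∂G.holdLaw s =
      ENNReal.ofReal (g * t + h s - Real.exp (-(G.exitRate s * t)) * h s) := by
  rw [← lintegral_expMeasure_affine hs ht hg (hh s)]
  unfold holdLaw
  rw [if_pos hs]
  refine lintegral_congr fun u => ?_
  split_ifs with hu
  · have hgu : 0 ≤ g * (t - u) := mul_nonneg hg (sub_nonneg.2 hu)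
    have hQ : ∀ s' ∈ Finset.univ.erase s, 0 ≤ G.Q s s' / G.exitRate s := fun s' hs' =>
      div_nonneg (G.nonneg s s' (Finset.ne_of_mem_erase hs').symm) hs.le
    rw [G.lintegral_jumpLaw hs]
    rw [Finset.sum_congr rfl fun s' hs' => (ENNReal.ofReal_mul (hQ s' hs')).symm,
      ← ENNReal.ofReal_sum_of_nonneg fun s' hs' => mul_nonneg (hQ s' hs')
        (add_nonneg (hR s s') (add_nonneg hgu (hh s')))]
    congr 1
    have e : ∀ s', G.Q s s' / G.exitRate s * (R s s' + (g * (t - u) + h s')) =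
        (G.Q s s' * (R s s' + h s') + G.Q s s' * (g * (t - u))) / G.exitRate s := by
      intro s'
      ring
    rw [Finset.sum_congr rfl fun s' _ => e s', ← Finset.sum_div, Finset.sum_add_distrib, hb s,
      ← Finset.sum_mul, G.sum_erase]
    field_simp
  · simp

/-- The balance of expected rewards and values between the stages `n` and `n + 1`. -/
theorem transitionReward_add (G : Generator S) (hG : ∀ s, 0 < G.exitRate s) {R : S → S → ℝ}
    (hR : ∀ s s', 0 ≤ R s s') {g : ℝ} (hg : 0 ≤ g) {h : S → ℝ} (hh : ∀ s, 0 ≤ h s)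
    (hb : G.IsBias R g h) (s₀ : S) (T : ℝ) (n : ℕ) :
    G.transitionReward s₀ T R n + G.stageValue s₀ T (fun s t => g * t + h s) (n + 1) +
        G.stageValue s₀ T (fun s t => Real.exp (-(G.exitRate s * t)) * h s) n =
      G.stageValue s₀ T (fun s t => g * t + h s) n := by
  unfold transitionReward stageValue
  rw [← lintegral_add_left (measurable_transition_integrand T R n)]
  have e1 : ∀ ω : ℕ → S × ℝ,
      (if stageStart ω (n + 1) ≤ T then ENNReal.ofReal (R (ω n).1 (ω (n + 1)).1) else 0) +
        (if stageStart ω (n + 1) ≤ T then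
          ENNReal.ofReal (g * (T - stageStart ω (n + 1)) + h (ω (n + 1)).1) else 0) =
      (fun τ s s' => if τ ≤ T then ENNReal.ofReal (R s s' + (g * (T - τ) + h s')) else 0)
        (stageStart ω (n + 1)) (ω n).1 (ω (n + 1)).1 := by
    intro ω
    beta_reduce
    split_ifs with hT
    · exact (ENNReal.ofReal_add (hR _ _)
        (add_nonneg (mul_nonneg hg (sub_nonneg.2 hT)) (hh _))).symm
    · simp
  rw [lintegral_congr e1, G.lintegral_law_transition s₀ n
    (f := fun τ s s' => if τ ≤ T then ENNReal.ofReal (R s s' + (g * (T - τ) + h s')) else 0)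
    (measurable_from_prod_countable_left fun p =>
      Measurable.ite measurableSet_Iic (by fun_prop) measurable_const),
    ← lintegral_add_right _ (measurable_stage_integrand
      (f := fun s t => Real.exp (-(G.exitRate s * t)) * h s) (fun s => by fun_prop) n)]
  refine lintegral_congr fun ω => ?_
  generalize stageStart ω n = τ
  generalize (ω n).1 = s
  have e2 : ∀ u s', (if τ + u ≤ T then ENNReal.ofReal (R s s' + (g * (T - (τ + u)) + h s'))
      else 0) = if u ≤ T - τ then ENNReal.ofReal (R s s' + (g * (T - τ - u) + h s')) else 0 := by
    intro u s'
    simp only [le_sub_iff_add_le', sub_sub]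
  simp only [e2]
  by_cases hT : τ ≤ T
  -- The exponential summand restores exactly what is lost when the state is not left by time `T`;
  -- keeping it as a summand avoids truncated subtraction in `ℝ≥0∞`.
  · rw [G.lintegral_transition_bias hR hg hh hb (hG s) (sub_nonneg.2 hT), if_pos hT, if_pos hT,
      ← ENNReal.ofReal_add _ (mul_nonneg (Real.exp_nonneg _) (hh s)), sub_add_cancel]
    have h1 : Real.exp (-(G.exitRate s * (T - τ))) * h s ≤ h s :=
      mul_le_of_le_one_left (hh s) (Real.exp_le_one_iff.2
        (neg_nonpos.2 (mul_nonneg (hG s).le (sub_nonneg.2 hT))))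
    have h2 := mul_nonneg hg (sub_nonneg.2 hT)
    linarith
  -- A stage that begins after `T` could end by `T` only with a negative duration, which has
  -- probability zero.
  · rw [if_neg hT, if_neg hT, add_zero]
    unfold holdLaw
    rw [if_pos (hG s)]
    have e3 : ∀ u, ∫⁻ s', (if u ≤ T - τ then
        ENNReal.ofReal (R s s' + (g * (T - τ - u) + h s')) else 0) ∂G.jumpLaw s =
        if u ≤ T - τ then ∑ s' ∈ Finset.univ.erase s, ENNReal.ofReal (G.Q s s' / G.exitRate s) *
          ENNReal.ofReal (R s s' + (g * (T - τ - u) + h s')) else 0 := by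
      intro u
      split_ifs
      · exact G.lintegral_jumpLaw (hG s) _
      · simp
    rw [lintegral_congr e3]
    exact lintegral_expMeasure_of_neg (sub_neg.2 (not_le.1 hT)) _ (by fun_prop)

theorem stageValue_zero (G : Generator S) (s₀ : S) {T : ℝ} (hT : 0 ≤ T) (f : S → ℝ → ℝ) :
    G.stageValue s₀ T f 0 = ENNReal.ofReal (f s₀ T) := by
  have h : ∀ᵐ ω ∂G.law s₀, (if stageStart ω 0 ≤ T then
      ENNReal.ofReal (f (ω 0).1 (T - stageStart ω 0)) else 0) = ENNReal.ofReal (f s₀ T) := by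
    filter_upwards [G.ae_state_zero s₀] with ω hω
    rw [stageStart_zero, if_pos hT, hω, sub_zero]
  unfold stageValue
  rw [lintegral_congr_ae h, lintegral_const, measure_univ, mul_one]

/-- The balance between consecutive stages telescopes. The second sum is the expected bias of the
state occupied at `T`, as far as the first `n` stages cover that time. -/
theorem sum_transitionReward_add (G : Generator S) (hG : ∀ s, 0 < G.exitRate s) {R : S → S → ℝ}
    (hR : ∀ s s', 0 ≤ R s s') {g : ℝ} (hg : 0 ≤ g) {h : S → ℝ} (hh : ∀ s, 0 ≤ h s)
    (hb : G.IsBias R g h) (s₀ : S) {T : ℝ} (hT : 0 ≤ T) (n : ℕ) :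
    ∑ k ∈ Finset.range n, G.transitionReward s₀ T R k +
        ∑ k ∈ Finset.range n,
          G.stageValue s₀ T (fun s t => Real.exp (-(G.exitRate s * t)) * h s) k +
        G.stageValue s₀ T (fun s t => g * t + h s) n =
      ENNReal.ofReal (g * T + h s₀) := by
  induction n with
  | zero => simp [G.stageValue_zero s₀ hT]
  | succ n ih =>
    rw [← ih, ← G.transitionReward_add hG hR hg hh hb s₀ T n, Finset.sum_range_succ,
      Finset.sum_range_succ]
    ring

theorem tsum_transitionReward_le (G : Generator S) (hG : ∀ s, 0 < G.exitRate s) {R : S → S → ℝ}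
    (hR : ∀ s s', 0 ≤ R s s') {g : ℝ} (hg : 0 ≤ g) {h : S → ℝ} (hh : ∀ s, 0 ≤ h s)
    (hb : G.IsBias R g h) (s₀ : S) {T : ℝ} (hT : 0 ≤ T) :
    ∑' n, G.transitionReward s₀ T R n ≤ ENNReal.ofReal (g * T + h s₀) := by
  rw [ENNReal.tsum_eq_iSup_nat]
  refine iSup_le fun n => ?_
  rw [← G.sum_transitionReward_add hG hR hg hh hb s₀ hT n, add_assoc]
  exact le_self_add

/-- The `n`-th term is the probability that stage `n` is in progress at time `T`. Reward `0`, gain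
`0` and bias `1` solve the bias equation, and the telescoped identity then bounds the partial sums.
-/
theorem tsum_stageValue_exp_le (G : Generator S) (hG : ∀ s, 0 < G.exitRate s) (s₀ : S) {T : ℝ}
    (hT : 0 ≤ T) :
    ∑' n, G.stageValue s₀ T (fun s t => Real.exp (-(G.exitRate s * t))) n ≤ 1 := by
  have hb : G.IsBias (fun _ _ => 0) 0 fun _ => 1 := by
    intro s
    simp [G.sum_erase]
  rw [ENNReal.tsum_eq_iSup_nat]
  refine iSup_le fun n => ?_
  have h := G.sum_transitionReward_add hG (fun _ _ => le_rfl) le_rfl (fun _ => zero_le_one) hb s₀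
    hT n
  simp only [mul_one, zero_mul, zero_add, ENNReal.ofReal_one] at h
  rw [← h, add_right_comm]
  exact le_add_self

/-- The number of stages begun by time `T` has a finite expectation. -/
theorem tsum_measure_stageStart_ne_top (G : Generator S) (hG : ∀ s, 0 < G.exitRate s) (s₀ : S)
    {T : ℝ} (hT : 0 ≤ T) : ∑' n, G.law s₀ {ω | stageStart ω (n + 1) ≤ T} ≠ ∞ := by
  -- A reward equal to the mean holding time is earned at rate `1` in every state, so its total is
  -- at most `T` in expectation. Each transition earns at least `1 / m`, with `m` a bound on the
  -- exit rates.
  have hb : G.IsBias (fun s _ => (G.exitRate s)⁻¹) 1 fun _ => 0 := by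
    intro s
    simp [← Finset.sum_mul, G.sum_erase, (hG s).ne']
  have hle := G.tsum_transitionReward_le hG (fun s _ => (inv_pos.2 (hG s)).le) zero_le_one
    (fun _ => le_rfl) hb s₀ hT
  obtain ⟨m, hm⟩ : ∃ m, ∀ s, G.exitRate s ≤ m := by
    obtain ⟨m, hm⟩ := (Set.finite_range G.exitRate).bddAbove
    exact ⟨m, fun s => hm ⟨s, rfl⟩⟩
  have hm0 : 0 < m := (hG s₀).trans_le (hm s₀)
  have hn : ∀ n, ENNReal.ofReal m⁻¹ * G.law s₀ {ω | stageStart ω (n + 1) ≤ T} ≤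
      G.transitionReward s₀ T (fun s _ => (G.exitRate s)⁻¹) n := by
    intro n
    have hmeas : MeasurableSet {ω : ℕ → S × ℝ | stageStart ω (n + 1) ≤ T} :=
      measurableSet_le (measurable_stageStart _) measurable_const
    rw [← lintegral_indicator_const hmeas]
    refine lintegral_mono fun ω => ?_
    rw [Set.indicator_apply]
    simp only [Set.mem_ofPred_eq]
    split_ifs
    · exact ENNReal.ofReal_le_ofReal (inv_anti₀ (hG _) (hm _))
    · exact le_rfl
  intro htop
  have h1 := (ENNReal.tsum_le_tsum hn).trans hle
  rw [ENNReal.tsum_mul_left, htop, ENNReal.mul_top (by simpa using hm0)] at h1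
  exact ENNReal.ofReal_ne_top (top_le_iff.1 h1)

/-- Borel–Cantelli: for each integer horizon only finitely many stages begin by then, so the chain
does not explode. -/
theorem ae_stageStart_unbounded (G : Generator S) (hG : ∀ s, 0 < G.exitRate s) (s₀ : S) :
    ∀ᵐ ω ∂G.law s₀, ∀ T : ℝ, ∃ n, T < stageStart ω n := by
  have h : ∀ᵐ ω ∂G.law s₀, ∀ m : ℕ, ∃ n, (m : ℝ) < stageStart ω n := by
    rw [ae_all_iff]
    intro m
    filter_upwards [ae_eventually_notMem
      (G.tsum_measure_stageStart_ne_top hG s₀ (Nat.cast_nonneg m))] with ω hω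
    obtain ⟨n, hn⟩ := hω.exists
    exact ⟨n + 1, not_le.1 hn⟩
  filter_upwards [h] with ω hω T
  obtain ⟨m, hm⟩ := exists_nat_ge T
  obtain ⟨n, hn⟩ := hω m
  exact ⟨n, hm.trans_lt hn⟩

theorem tendsto_stageValue (G : Generator S) (hG : ∀ s, 0 < G.exitRate s) (s₀ : S) {T : ℝ}
    (hT : 0 ≤ T) {f : S → ℝ → ℝ} {C : ℝ} (hf : ∀ s t, t ≤ T → f s t ≤ C) :
    Tendsto (G.stageValue s₀ T f) atTop (𝓝 0) := by
  rw [← tendsto_add_atTop_iff_nat 1]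
  have h1 : Tendsto (fun n => ENNReal.ofReal C * G.law s₀ {ω | stageStart ω (n + 1) ≤ T}) atTop
      (𝓝 (ENNReal.ofReal C * 0)) :=
    ENNReal.Tendsto.const_mul (ENNReal.tendsto_atTop_zero_of_tsum_ne_top
      (G.tsum_measure_stageStart_ne_top hG s₀ hT)) (Or.inr ENNReal.ofReal_ne_top)
  rw [mul_zero] at h1
  refine tendsto_of_tendsto_of_tendsto_of_le_of_le tendsto_const_nhds h1 (fun _ => zero_le)
    fun n => ?_
  have hmeas : MeasurableSet {ω : ℕ → S × ℝ | stageStart ω (n + 1) ≤ T} :=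
    measurableSet_le (measurable_stageStart _) measurable_const
  beta_reduce
  rw [← lintegral_indicator_const hmeas]
  refine lintegral_mono_ae ?_
  filter_upwards [G.ae_hold_pos s₀] with ω hω
  have h0 : 0 ≤ stageStart ω (n + 1) := Finset.sum_nonneg fun k _ => (hω k).le
  rw [Set.indicator_apply]
  simp only [Set.mem_ofPred_eq]
  split_ifs
  · exact ENNReal.ofReal_le_ofReal (hf _ _ (by linarith))
  · exact le_rfl

/-- In the telescoped identity the retained bias is at most `C` times a total probability of at most
one, and the value of the `n`-th stage tends to zero because reaching stage `n` by time `T` becomes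
improbable. -/
theorem le_tsum_transitionReward (G : Generator S) (hG : ∀ s, 0 < G.exitRate s) {R : S → S → ℝ}
    (hR : ∀ s s', 0 ≤ R s s') {g : ℝ} (hg : 0 ≤ g) {h : S → ℝ} (hh : ∀ s, 0 ≤ h s)
    (hb : G.IsBias R g h) {C : ℝ} (hC : ∀ s, h s ≤ C) (s₀ : S) {T : ℝ} (hT : 0 ≤ T) :
    ENNReal.ofReal (g * T + h s₀) ≤ ∑' n, G.transitionReward s₀ T R n + ENNReal.ofReal C := by
  have hexp : ∀ n, ∑ k ∈ Finset.range n,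
      G.stageValue s₀ T (fun s t => Real.exp (-(G.exitRate s * t)) * h s) k ≤
        ENNReal.ofReal C := by
    intro n
    calc _ ≤ ∑ k ∈ Finset.range n, ENNReal.ofReal C *
          G.stageValue s₀ T (fun s t => Real.exp (-(G.exitRate s * t))) k := by
          refine Finset.sum_le_sum fun k _ => ?_
          unfold stageValue
          rw [← lintegral_const_mul' _ _ ENNReal.ofReal_ne_top]
          refine lintegral_mono fun ω => ?_
          beta_reduce
          split_ifs
          · rw [mul_comm (Real.exp _), ENNReal.ofReal_mul (hh _)]
            gcongr
            exact hC _
          · simp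
      _ ≤ ENNReal.ofReal C * 1 := by
          rw [← Finset.mul_sum]
          gcongr
          exact (ENNReal.sum_le_tsum _).trans (G.tsum_stageValue_exp_le hG s₀ hT)
      _ = _ := mul_one _
  have hlim : Tendsto (fun n => ∑' n, G.transitionReward s₀ T R n + ENNReal.ofReal C +
      G.stageValue s₀ T (fun s t => g * t + h s) n) atTop
      (𝓝 (∑' n, G.transitionReward s₀ T R n + ENNReal.ofReal C + 0)) :=
    (G.tendsto_stageValue hG s₀ hT (C := g * T + C) fun s t ht =>
      add_le_add (mul_le_mul_of_nonneg_left ht hg) (hC s)).const_add _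
  rw [add_zero] at hlim
  refine ge_of_tendsto' hlim fun n => ?_
  rw [← G.sum_transitionReward_add hG hR hg hh hb s₀ hT n]
  gcongr
  · exact ENNReal.sum_le_tsum _
  · exact hexp n

end Generator

/-! ### Change times of a regular path -/

section Path

variable {S : Type} {ω : ℕ → S × ℝ}

theorem strictMono_stageStart (hpos : ∀ n, 0 < (ω n).2) : StrictMono (stageStart ω) :=
  strictMono_nat_of_lt_succ fun n => by
    rw [stageStart_succ]
    linarith [hpos n]

theorem stageStart_nonneg (hpos : ∀ n, 0 < (ω n).2) (n : ℕ) : 0 ≤ stageStart ω n :=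
  Finset.sum_nonneg fun k _ => (hpos k).le

theorem chainAt_eq_of_mem_Ico (hpos : ∀ n, 0 < (ω n).2) {t : ℝ≥0} {n : ℕ}
    (h1 : stageStart ω n ≤ t) (h2 : t < stageStart ω (n + 1)) : chainAt ω t = (ω n).1 := by
  have h : sInf {m : ℕ | (t : ℝ) < ∑ k ∈ Finset.range (m + 1), (ω k).2} = n := by
    refine IsLeast.csInf_eq ⟨h2, fun m hm => ?_⟩
    have h3 : stageStart ω n < stageStart ω (m + 1) := h1.trans_lt hm
    exact Nat.lt_succ_iff.1 ((strictMono_stageStart hpos).lt_iff_lt.1 h3)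
  unfold chainAt
  rw [h]

theorem chainAt_stageStart (hpos : ∀ n, 0 < (ω n).2) (n : ℕ) :
    chainAt ω (stageStart ω n).toNNReal = (ω n).1 := by
  have h : ((stageStart ω n).toNNReal : ℝ) = stageStart ω n :=
    Real.coe_toNNReal _ (stageStart_nonneg hpos n)
  refine chainAt_eq_of_mem_Ico hpos h.ge ?_
  rw [h]
  exact strictMono_stageStart hpos n.lt_succ_self

theorem exists_stage (hunb : ∀ T : ℝ, ∃ n, T < stageStart ω n) (t : ℝ≥0) :
    ∃ n, stageStart ω n ≤ t ∧ t < stageStart ω (n + 1) := by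
  classical
  have h := hunb t
  obtain ⟨n, hn⟩ : ∃ n, Nat.find h = n + 1 := by
    refine Nat.exists_eq_succ_of_ne_zero fun h0 => ?_
    have h1 := Nat.find_spec h
    rw [h0, stageStart_zero] at h1
    exact absurd h1 (not_lt.2 t.coe_nonneg)
  refine ⟨n, not_lt.1 (Nat.find_min h (by omega)), ?_⟩
  rw [← hn]
  exact Nat.find_spec h

theorem eventually_chainAt_eq (hpos : ∀ n, 0 < (ω n).2) {t : ℝ≥0} {n : ℕ}
    (h1 : stageStart ω n < t) (h2 : t ≤ stageStart ω (n + 1)) :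
    ∀ᶠ u in 𝓝[<] t, chainAt ω u = (ω n).1 := by
  have h3 : (stageStart ω n).toNNReal < t := by
    rwa [Real.toNNReal_lt_iff_lt_coe (stageStart_nonneg hpos n)]
  filter_upwards [Ioo_mem_nhdsLT h3] with u hu
  refine chainAt_eq_of_mem_Ico hpos (Real.toNNReal_le_iff_le_coe.1 hu.1.le) ?_
  exact lt_of_lt_of_le (NNReal.coe_lt_coe.2 hu.2) h2

theorem changesAt_chainAt_iff (hpos : ∀ n, 0 < (ω n).2) (hne : ∀ n, (ω (n + 1)).1 ≠ (ω n).1)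
    (hunb : ∀ T : ℝ, ∃ n, T < stageStart ω n) (t : ℝ≥0) :
    ChangesAt (chainAt ω) t ↔ ∃ n, (t : ℝ) = stageStart ω (n + 1) := by
  constructor
  · intro hc
    obtain ⟨n, h1, h2⟩ := exists_stage hunb t
    rcases h1.eq_or_lt with h1 | h1
    · cases n with
      | zero =>
        -- No time precedes `0`, so `𝓝[<] 0` is trivial and the start of stage `0` does not count as
        -- a change.
        rw [stageStart_zero] at h1
        have ht : t = 0 := (NNReal.coe_eq_zero).1 h1.symm
        subst ht
        refine absurd ?_ hc
        have : Set.Iio (0 : ℝ≥0) = ∅ := by ext; simp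
        rw [this, nhdsWithin_empty]
        exact eventually_bot
      | succ n => exact ⟨n, h1.symm⟩
    · refine absurd ?_ hc
      rw [chainAt_eq_of_mem_Ico hpos h1.le h2]
      exact eventually_chainAt_eq hpos h1 h2.le
  · rintro ⟨n, hn⟩ hc
    have h1 := eventually_chainAt_eq (n := n) hpos
      (hn ▸ strictMono_stageStart hpos n.lt_succ_self) hn.le
    have h2 : chainAt ω t = (ω (n + 1)).1 :=
      chainAt_eq_of_mem_Ico hpos hn.ge (hn ▸ strictMono_stageStart hpos (n + 1).lt_succ_self)
    have ht : 0 < t := by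
      rw [← NNReal.coe_pos, hn]
      exact (stageStart_nonneg hpos n).trans_lt (strictMono_stageStart hpos n.lt_succ_self)
    have : (𝓝[<] t).NeBot := nhdsLT_neBot_of_exists_lt ⟨0, ht⟩
    obtain ⟨u, hu1, hu2⟩ := (h1.and hc).exists
    exact hne n (h2.symm.trans (hu2.symm.trans hu1))

/-- Changes occur exactly at the starts of stages `m + 1`; these strictly increase, so the infimum
over those after stage `n` began is attained at `m = n`. -/
theorem changeTime_chainAt (hpos : ∀ n, 0 < (ω n).2) (hne : ∀ n, (ω (n + 1)).1 ≠ (ω n).1)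
    (hunb : ∀ T : ℝ, ∃ n, T < stageStart ω n) (n : ℕ) :
    changeTime (chainAt ω) n = ENNReal.ofReal (stageStart ω n) := by
  induction n with
  | zero => simp [changeTime, stageStart_zero]
  | succ n ih =>
    have hmono := strictMono_stageStart hpos
    unfold changeTime
    rw [ih]
    refine IsLeast.csInf_eq ⟨⟨(stageStart ω (n + 1)).toNNReal, ⟨?_, ?_⟩, rfl⟩, ?_⟩
    · exact (ENNReal.ofReal_lt_ofReal_iff_of_nonneg (stageStart_nonneg hpos n)).2
        (hmono n.lt_succ_self)
    · exact (changesAt_chainAt_iff hpos hne hunb _).2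
        ⟨n, Real.coe_toNNReal _ (stageStart_nonneg hpos _)⟩
    · rintro _ ⟨t, ⟨h1, h2⟩, rfl⟩
      obtain ⟨m, hm⟩ := (changesAt_chainAt_iff hpos hne hunb t).1 h2
      have e : (t : ℝ≥0∞) = ENNReal.ofReal (stageStart ω (m + 1)) := by
        rw [← hm, ENNReal.ofReal_coe_nnreal]
      beta_reduce
      rw [e] at h1 ⊢
      rw [ENNReal.ofReal_lt_ofReal_iff_of_nonneg (stageStart_nonneg hpos n),
        hmono.lt_iff_lt] at h1
      exact ENNReal.ofReal_le_ofReal (hmono.monotone h1)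

theorem totalReward_chainAt (hpos : ∀ n, 0 < (ω n).2) (hne : ∀ n, (ω (n + 1)).1 ≠ (ω n).1)
    (hunb : ∀ T : ℝ, ∃ n, T < stageStart ω n) (R : S → S → ℝ) (T : ℝ≥0) :
    totalReward R (chainAt ω) T = ∑' n, if stageStart ω (n + 1) ≤ T then
      ENNReal.ofReal (R (ω n).1 (ω (n + 1)).1) else 0 := by
  unfold totalReward
  refine tsum_congr fun n => ?_
  have h : ∀ n, (ENNReal.ofReal (stageStart ω n)).toNNReal = (stageStart ω n).toNNReal :=
    fun _ => rfl
  simp only [changeTime_chainAt hpos hne hunb, h, chainAt_stageStart hpos]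
  rw [← ENNReal.ofReal_coe_nnreal]
  simp only [ENNReal.ofReal_le_ofReal_iff T.coe_nonneg]

end Path

/-! ### Convergence of the expected time average -/

namespace Generator

variable {S : Type} [Fintype S] [DecidableEq S] [MeasurableSpace S] [DiscreteMeasurableSpace S]

/-- Almost every path is regular, so the total reward agrees almost everywhere with a series of
measurable terms; measurability of `totalReward` itself is not needed. -/
theorem lintegral_totalReward (G : Generator S) (hG : ∀ s, 0 < G.exitRate s) (s₀ : S)
    (R : S → S → ℝ) (T : ℝ≥0) :
    ∫⁻ ω, totalReward R (chainAt ω) T ∂G.law s₀ = ∑' n, G.transitionReward s₀ T R n := by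
  have h : ∀ᵐ ω ∂G.law s₀, totalReward R (chainAt ω) T = ∑' n,
      if stageStart ω (n + 1) ≤ T then ENNReal.ofReal (R (ω n).1 (ω (n + 1)).1) else 0 := by
    filter_upwards [G.ae_hold_pos s₀, G.ae_state_ne hG s₀, G.ae_stageStart_unbounded hG s₀]
      with ω h1 h2 h3
    exact totalReward_chainAt h1 h2 h3 R T
  rw [lintegral_congr_ae h]
  exact lintegral_tsum fun n => (measurable_transition_integrand T R n).aemeasurable

/-- If the reward `R` has a bias, its expected time average converges to the gain. -/
theorem tendsto_lintegral_totalReward_div (G : Generator S) (hG : ∀ s, 0 < G.exitRate s)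
    {R : S → S → ℝ} (hR : ∀ s s', 0 ≤ R s s') {g : ℝ} (hg : 0 ≤ g) {h : S → ℝ}
    (hh : ∀ s, 0 ≤ h s) (hb : G.IsBias R g h) (s₀ : S) :
    (∀ T : ℝ≥0, ∫⁻ ω, totalReward R (chainAt ω) T ∂G.law s₀ ≠ ∞) ∧
      Tendsto (fun T : ℝ≥0 => (∫⁻ ω, totalReward R (chainAt ω) T ∂G.law s₀).toReal / (T : ℝ))
        atTop (𝓝 g) := by
  obtain ⟨C, hC⟩ : ∃ C, ∀ s, h s ≤ C := by
    obtain ⟨C, hC⟩ := (Set.finite_range h).bddAbove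
    exact ⟨C, fun s => hC ⟨s, rfl⟩⟩
  have hC0 : 0 ≤ C := (hh s₀).trans (hC s₀)
  have hup : ∀ T : ℝ≥0, ∫⁻ ω, totalReward R (chainAt ω) T ∂G.law s₀ ≤
      ENNReal.ofReal (g * T + h s₀) := fun T => by
    rw [G.lintegral_totalReward hG]
    exact G.tsum_transitionReward_le hG hR hg hh hb s₀ T.coe_nonneg
  have hlow : ∀ T : ℝ≥0, ENNReal.ofReal (g * T + h s₀) ≤
      ∫⁻ ω, totalReward R (chainAt ω) T ∂G.law s₀ + ENNReal.ofReal C := fun T => by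
    rw [G.lintegral_totalReward hG]
    exact G.le_tsum_transitionReward hG hR hg hh hb hC s₀ T.coe_nonneg
  have hfin : ∀ T : ℝ≥0, ∫⁻ ω, totalReward R (chainAt ω) T ∂G.law s₀ ≠ ∞ := fun T =>
    ne_top_of_le_ne_top ENNReal.ofReal_ne_top (hup T)
  refine ⟨hfin, ?_⟩
  have hval : ∀ T : ℝ≥0, 0 ≤ g * T + h s₀ := fun T =>
    add_nonneg (mul_nonneg hg T.coe_nonneg) (hh s₀)
  have hup' : ∀ T : ℝ≥0, (∫⁻ ω, totalReward R (chainAt ω) T ∂G.law s₀).toReal ≤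
      g * T + C := fun T =>
    (ENNReal.toReal_le_of_le_ofReal (hval T) (hup T)).trans (by linarith [hC s₀])
  have hlow' : ∀ T : ℝ≥0, g * T - C ≤
      (∫⁻ ω, totalReward R (chainAt ω) T ∂G.law s₀).toReal := fun T => by
    have h1 := ENNReal.toReal_mono (ENNReal.add_ne_top.2 ⟨hfin T, ENNReal.ofReal_ne_top⟩) (hlow T)
    rw [ENNReal.toReal_add (hfin T) ENNReal.ofReal_ne_top, ENNReal.toReal_ofReal (hval T),
      ENNReal.toReal_ofReal hC0] at h1
    linarith [hh s₀]
  have hcoe : Tendsto (fun T : ℝ≥0 => (T : ℝ)) atTop atTop := NNReal.tendsto_coe_atTop.2 tendsto_id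
  have hdiv : Tendsto (fun T : ℝ≥0 => C / (T : ℝ)) atTop (𝓝 0) := hcoe.const_div_atTop C
  have h1 : Tendsto (fun T : ℝ≥0 => g - C / (T : ℝ)) atTop (𝓝 g) := by
    simpa using hdiv.const_sub g
  have h2 : Tendsto (fun T : ℝ≥0 => g + C / (T : ℝ)) atTop (𝓝 g) := by
    simpa using hdiv.const_add g
  refine tendsto_of_tendsto_of_tendsto_of_le_of_le' h1 h2 ?_ ?_
  · filter_upwards [eventually_gt_atTop 0] with T hT
    have hT' : (0 : ℝ) < T := hT
    rw [le_div_iff₀ hT', sub_mul, div_mul_cancel₀ _ hT'.ne']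
    exact hlow' T
  · filter_upwards [eventually_gt_atTop 0] with T hT
    have hT' : (0 : ℝ) < T := hT
    rw [div_le_iff₀ hT', add_mul, div_mul_cancel₀ _ hT'.ne']
    exact hup' T

end Generator

/-! ### Maximum principle and Poisson equation -/

namespace Generator

variable {S : Type} [Fintype S]

theorem sum_mul_sub (G : Generator S) (h : S → ℝ) (s : S) :
    ∑ s', G.Q s s' * (h s' - h s) = ∑ s', G.Q s s' * h s' := by
  simp only [mul_sub, Finset.sum_sub_distrib, ← Finset.sum_mul, G.sum_zero, zero_mul, sub_zero]

theorem mul_sub_nonpos (G : Generator S) {h : S → ℝ} {s : S} (hs : ∀ s', h s' ≤ h s) (s' : S) :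
    G.Q s s' * (h s' - h s) ≤ 0 := by
  by_cases e : s = s'
  · simp [e]
  · exact mul_nonpos_of_nonneg_of_nonpos (G.nonneg s s' e) (sub_nonpos.2 (hs s'))

theorem sum_mul_nonpos_of_max (G : Generator S) {h : S → ℝ} {s : S} (hs : ∀ s', h s' ≤ h s) :
    ∑ s', G.Q s s' * h s' ≤ 0 := by
  rw [← G.sum_mul_sub]
  exact Finset.sum_nonpos fun s' _ => G.mul_sub_nonpos hs s'

theorem sum_mul_nonneg_of_min (G : Generator S) {h : S → ℝ} {s : S} (hs : ∀ s', h s ≤ h s') :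
    0 ≤ ∑ s', G.Q s s' * h s' := by
  have h1 := G.sum_mul_nonpos_of_max (h := fun s => -h s) fun s' => neg_le_neg (hs s')
  simp only [mul_neg, Finset.sum_neg_distrib] at h1
  linarith

/-- The strong maximum principle. -/
theorem harmonic_le_of_reachable (G : Generator S) {h : S → ℝ}
    (hQ : ∀ s, ∑ s', G.Q s s' * h s' = 0) {o : S}
    (ho : ∀ s, Relation.ReflTransGen (fun a b => 0 < G.Q a b) s o) (s : S) : h s ≤ h o := by
  have : Nonempty S := ⟨s⟩
  obtain ⟨m, hm⟩ := Finite.exists_max h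
  suffices e : h o = h m from e ▸ hm s
  -- Maximality spreads from `m` to `o` along transitions of positive rate: at a maximum the terms
  -- `Q b s' * (h s' - h b)` are nonpositive with sum zero, so each of them vanishes.
  refine Relation.ReflTransGen.rec (motive := fun b _ => h b = h m) rfl ?_ (ho m)
  intro b c _ hbc hb
  have hmax : ∀ s', h s' ≤ h b := fun s' => hb ▸ hm s'
  have h0 := hQ b
  rw [← G.sum_mul_sub, Finset.sum_eq_zero_iff_of_nonpos fun s' _ => G.mul_sub_nonpos hmax s'] at h0
  have h1 := (mul_eq_zero.1 (h0 c (Finset.mem_univ c))).resolve_left hbc.ne'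
  linarith

theorem harmonic_const_of_reachable (G : Generator S) {h : S → ℝ}
    (hQ : ∀ s, ∑ s', G.Q s s' * h s' = 0) {o : S}
    (ho : ∀ s, Relation.ReflTransGen (fun a b => 0 < G.Q a b) s o) (s : S) : h s = h o := by
  refine le_antisymm (G.harmonic_le_of_reachable hQ ho s) ?_
  refine neg_le_neg_iff.1 (G.harmonic_le_of_reachable (h := fun s => -h s) (fun s => ?_) ho s)
  simp only [mul_neg, Finset.sum_neg_distrib, hQ, neg_zero]

/-- Solvability of the Poisson equation for a chain with a single recurrent class. -/
theorem exists_poisson (G : Generator S) {o : S}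
    (ho : ∀ s, Relation.ReflTransGen (fun a b => 0 < G.Q a b) s o) (ρ : S → ℝ) :
    ∃ (g : ℝ) (h : S → ℝ), ∀ s, ρ s + ∑ s', G.Q s s' * h s' = g := by
  have : Nonempty S := ⟨o⟩
  -- Since `h` is determined only up to a constant, `h o` can play the role of the unknown gain;
  -- this makes the system square.
  let Φ : (S → ℝ) →ₗ[ℝ] (S → ℝ) :=
    { toFun := fun h s => h o - ∑ s', G.Q s s' * h s'
      map_add' := fun h k => by
        ext s
        simp only [Pi.add_apply, mul_add, Finset.sum_add_distrib]
        ring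
      map_smul' := fun c h => by
        ext s
        simp only [Pi.smul_apply, smul_eq_mul, RingHom.id_apply, mul_sub, Finset.mul_sum]
        congr 1
        exact Finset.sum_congr rfl fun s' _ => by ring }
  have hinj : Function.Injective Φ := by
    rw [← LinearMap.ker_eq_bot, LinearMap.ker_eq_bot']
    intro h hh
    have hΦ : ∀ s, h o - ∑ s', G.Q s s' * h s' = 0 := fun s => congrFun hh s
    obtain ⟨a, ha⟩ := Finite.exists_max h
    obtain ⟨b, hb⟩ := Finite.exists_min h
    -- On the kernel `Q h` is the constant `h o`, which is nonpositive at a maximum of `h` and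
    -- nonnegative at a minimum. So `h` is harmonic, hence constant.
    have h0 : h o = 0 := by
      linarith [hΦ a, hΦ b, G.sum_mul_nonpos_of_max ha, G.sum_mul_nonneg_of_min hb]
    ext s
    rw [G.harmonic_const_of_reachable (h := h) (fun s => by linarith [hΦ s]) ho s, h0, Pi.zero_apply]
  obtain ⟨h, hh⟩ := (LinearMap.injective_iff_surjective.1 hinj) ρ
  refine ⟨h o, h, fun s => ?_⟩
  rw [← congrFun hh s]
  exact sub_add_cancel _ _

variable [DecidableEq S]

theorem isBias_iff (G : Generator S) {R : S → S → ℝ} {g : ℝ} {h : S → ℝ} :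
    G.IsBias R g h ↔ ∀ s, ∑ s' ∈ Finset.univ.erase s, G.Q s s' * R s s' +
      ∑ s', G.Q s s' * h s' = g := by
  refine forall_congr' fun s => ?_
  rw [← Finset.add_sum_erase Finset.univ _ (Finset.mem_univ s)]
  simp only [mul_add, Finset.sum_add_distrib, exitRate]
  constructor <;> intro e <;> linarith

/-- At a maximum of `h` the drift `Q h` is nonpositive, so the gain is at most the reward rate in
that single state. -/
theorem IsBias.gain_le {G : Generator S} {R : S → S → ℝ} {g : ℝ} {h : S → ℝ}
    (hb : G.IsBias R g h) [Nonempty S] {M : ℝ}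
    (hM : ∀ s, ∑ s' ∈ Finset.univ.erase s, G.Q s s' * R s s' ≤ M) : g ≤ M := by
  obtain ⟨a, ha⟩ := Finite.exists_max h
  linarith [G.isBias_iff.1 hb a, hM a, G.sum_mul_nonpos_of_max ha]

theorem IsBias.gain_nonneg {G : Generator S} {R : S → S → ℝ} {g : ℝ} {h : S → ℝ}
    (hb : G.IsBias R g h) [Nonempty S] (hR : ∀ s s', 0 ≤ R s s') : 0 ≤ g := by
  obtain ⟨a, ha⟩ := Finite.exists_min h
  have h1 : 0 ≤ ∑ s' ∈ Finset.univ.erase a, G.Q a s' * R a s' :=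
    Finset.sum_nonneg fun s' hs' =>
      mul_nonneg (G.nonneg a s' (Finset.ne_of_mem_erase hs').symm) (hR a s')
  linarith [G.isBias_iff.1 hb a, G.sum_mul_nonneg_of_min ha]

theorem exists_isBias (G : Generator S) {o : S}
    (ho : ∀ s, Relation.ReflTransGen (fun a b => 0 < G.Q a b) s o) (R : S → S → ℝ) :
    ∃ (g : ℝ) (h : S → ℝ), (∀ s, 0 ≤ h s) ∧ G.IsBias R g h := by
  have : Nonempty S := ⟨o⟩
  obtain ⟨g, h, hh⟩ := G.exists_poisson ho fun s => ∑ s' ∈ Finset.univ.erase s, G.Q s s' * R s s'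
  obtain ⟨b, hb⟩ := Finite.exists_min h
  refine ⟨g, fun s => h s - h b, fun s => sub_nonneg.2 (hb s), G.isBias_iff.2 fun s => ?_⟩
  simp only [mul_sub, Finset.sum_sub_distrib, ← Finset.sum_mul, G.sum_zero, zero_mul, sub_zero]
  exact hh s

end Generator

/-! ### The tandem line: emptying, entries and revenue -/

namespace TandemSystem

variable {J : ℕ} (Θ : TandemSystem J)

/-- The number of services still needed to empty the line. -/
def workload (s : Θ.State) : ℤ := ∑ i : Fin J, ((J : ℤ) - i) * ((s i : ℕ) : ℤ)

theorem workload_nonneg (s : Θ.State) : 0 ≤ Θ.workload s :=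
  Finset.sum_nonneg fun i _ => mul_nonneg (by have := i.2; omega) (Int.natCast_nonneg _)

theorem sum_mul_unitVec {k : ℕ} (hk : k ≤ J) :
    ∑ i : Fin J, ((J : ℤ) - i) * unitVec J k i = J - k := by
  rcases hk.lt_or_eq with h | h
  · rw [Finset.sum_eq_single ⟨k, h⟩]
    · simp [unitVec]
    · intro b _ hb
      have : (b : ℕ) ≠ k := fun e => hb (Fin.ext e)
      simp [unitVec, this]
    · simp
  · rw [h, sub_self]
    refine Finset.sum_eq_zero fun i _ => ?_
    have : (i : ℕ) ≠ J := i.2.ne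
    simp [unitVec, this]

/-- The moved job has weight `J - j` before and `J - (j + 1)` after. The weight at `J` is zero, so
departures from the last station need no separate case. -/
theorem workload_of_isService {j : Fin J} {s s' : Θ.State} (h : Θ.IsService j s s') :
    Θ.workload s' = Θ.workload s - 1 := by
  have e : ∀ i : Fin J, ((J : ℤ) - i) * ((s' i : ℕ) : ℤ) = ((J : ℤ) - i) * ((s i : ℕ) : ℤ) -
      ((J : ℤ) - i) * unitVec J j i + ((J : ℤ) - i) * unitVec J (j + 1) i := by
    intro i
    rw [h i]
    ring
  unfold workload
  rw [Finset.sum_congr rfl fun i _ => e i, Finset.sum_add_distrib, Finset.sum_sub_distrib,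
    sum_mul_unitVec j.2.le, sum_mul_unitVec j.2]
  push_cast
  ring

/-- The last nonempty station is never blocked: the next one is empty, with room for a job even
without buffer, or there is none. -/
theorem exists_isService {s : Θ.State} (hs : s ≠ 0) : ∃ j s', Θ.IsService j s s' := by
  have hne : (Finset.univ.filter fun i => s i ≠ 0).Nonempty := by
    obtain ⟨i, hi⟩ := Function.ne_iff.1 hs
    exact ⟨i, by simpa using hi⟩
  obtain ⟨j, hj, hmax⟩ := Finset.exists_max_image _ id hne
  rw [Finset.mem_filter] at hj
  have hj0 : (s j : ℕ) ≠ 0 := fun h => hj.2 (Fin.ext h)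
  have hzero : ∀ i : Fin J, (i : ℕ) = j + 1 → (s i : ℕ) = 0 := by
    intro i hi
    by_contra h
    have h1 : i ≤ j := hmax i (by simpa using fun e : s i = 0 => h (by simp [e]))
    have : (i : ℕ) ≤ j := h1
    omega
  refine ⟨j, fun i => ⟨if (i : ℕ) = j then s i - 1 else if (i : ℕ) = j + 1 then 1 else s i, ?_⟩,
    fun i => ?_⟩
  · have := (s i).2
    split_ifs <;> omega
  · simp only [unitVec]
    by_cases h1 : (i : ℕ) = j
    · have hij : i = j := Fin.ext h1
      subst hij
      simp
      omega
    · by_cases h2 : (i : ℕ) = j + 1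
      · simp [h2, hzero i h2]
      · simp [h1, h2]

theorem exists_isEntry_zero (hJ : 1 ≤ J) : ∃ s' : Θ.State, s' ≠ 0 ∧ Θ.IsEntry 0 s' := by
  refine ⟨fun i => if (i : ℕ) = 0 then 1 else 0, ?_, fun i => ?_⟩
  · rw [Function.ne_iff]
    exact ⟨⟨0, hJ⟩, by simp⟩
  · by_cases h : (i : ℕ) = 0 <;> simp [unitVec, h]

variable {A : Set ℝ} (π : Θ.State → A)

theorem generator_Q_of_ne {s s' : Θ.State} (h : s ≠ s') :
    (Θ.generator π).Q s s' = Θ.rate π s s' :=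
  if_neg h

theorem rate_pos_of_isService (hentry : ∀ a ∈ A, 0 < Θ.entryProb a) {j : Fin J} {s s' : Θ.State}
    (h : Θ.IsService j s s') : 0 < Θ.rate π s s' := by
  unfold rate
  -- `rate` tests for an entry first; both branches are positive, so entries and services need not
  -- be told apart.
  split_ifs
  · exact mul_pos Θ.lam_pos (hentry _ (π s).2)
  · refine Finset.sum_pos' (fun i _ => ?_) ⟨j, Finset.mem_univ j, ?_⟩
    · split_ifs
      exacts [(Θ.μ_pos i).le, le_rfl]
    · rw [if_pos h]
      exact Θ.μ_pos j

theorem exists_Q_pos_workload_lt (hentry : ∀ a ∈ A, 0 < Θ.entryProb a) {s : Θ.State}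
    (hs : s ≠ 0) : ∃ s', s ≠ s' ∧ 0 < (Θ.generator π).Q s s' ∧ Θ.workload s' < Θ.workload s := by
  obtain ⟨j, s', h⟩ := Θ.exists_isService hs
  have hw := Θ.workload_of_isService h
  have hne : s ≠ s' := by
    rintro rfl
    omega
  refine ⟨s', hne, ?_, by omega⟩
  rw [Θ.generator_Q_of_ne π hne]
  exact Θ.rate_pos_of_isService π hentry h

theorem reachable_zero (hentry : ∀ a ∈ A, 0 < Θ.entryProb a) (s : Θ.State) :
    Relation.ReflTransGen (fun a b => 0 < (Θ.generator π).Q a b) s 0 := by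
  induction hn : (Θ.workload s).toNat using Nat.strong_induction_on generalizing s with
  | _ n ih =>
    by_cases hs : s = 0
    · rw [hs]
    · obtain ⟨s', -, hQ, hw⟩ := Θ.exists_Q_pos_workload_lt π hentry hs
      have := Θ.workload_nonneg s'
      exact Relation.ReflTransGen.head hQ (ih _ (by omega) s' rfl)

/-- The empty line admits an entry and every other state a service, so no policy creates an
absorbing state. -/
theorem exitRate_pos (hJ : 1 ≤ J) (hentry : ∀ a ∈ A, 0 < Θ.entryProb a) (s : Θ.State) :
    0 < (Θ.generator π).exitRate s := by
  rw [← Generator.sum_erase]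
  obtain ⟨s', hne, hQ⟩ : ∃ s', s ≠ s' ∧ 0 < (Θ.generator π).Q s s' := by
    by_cases hs : s = 0
    · obtain ⟨s', hne, h⟩ := Θ.exists_isEntry_zero hJ
      refine ⟨s', by rw [hs]; exact hne.symm, ?_⟩
      rw [hs, Θ.generator_Q_of_ne π hne.symm, rate, if_pos h]
      exact mul_pos Θ.lam_pos (hentry _ (π 0).2)
    · obtain ⟨s', hne, hQ, -⟩ := Θ.exists_Q_pos_workload_lt π hentry hs
      exact ⟨s', hne, hQ⟩
  exact Finset.sum_pos' (fun t ht => (Θ.generator π).nonneg s t (Finset.ne_of_mem_erase ht).symm)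
    ⟨s', Finset.mem_erase.2 ⟨hne.symm, Finset.mem_univ _⟩, hQ⟩

variable {Θ} in
theorem IsEntry.unique {s s' s'' : Θ.State} (h : Θ.IsEntry s s') (h' : Θ.IsEntry s s'') :
    s' = s'' := by
  ext i
  have := (h i).trans (h' i).symm
  exact_mod_cast this

theorem reward_nonneg (hA : ∀ a ∈ A, 0 ≤ a) (s s' : Θ.State) : 0 ≤ Θ.reward π s s' := by
  unfold reward
  split_ifs
  exacts [hA _ (π s).2, le_rfl]

/-- The rate at which revenue is earned in a state is at most the maximal revenue rate. -/
theorem sum_Q_mul_reward_le {M : ℝ} (hM0 : 0 ≤ M)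
    (hM : ∀ a ∈ A, a * Θ.lam * Θ.entryProb a ≤ M) (s : Θ.State) :
    ∑ s' ∈ Finset.univ.erase s, (Θ.generator π).Q s s' * Θ.reward π s s' ≤ M := by
  have hterm : ∀ s' ∈ Finset.univ.erase s, Θ.IsEntry s s' →
      (Θ.generator π).Q s s' * Θ.reward π s s' ≤ M := by
    intro s' hs' h
    rw [Θ.generator_Q_of_ne π (Finset.ne_of_mem_erase hs').symm, rate, reward, if_pos h, if_pos h]
    linarith [hM _ (π s).2]
  have hzero : ∀ s', ¬ Θ.IsEntry s s' → (Θ.generator π).Q s s' * Θ.reward π s s' = 0 := by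
    intro s' h
    rw [reward, if_neg h, mul_zero]
  by_cases hex : ∃ s' ∈ Finset.univ.erase s, Θ.IsEntry s s'
  · obtain ⟨s', hs', h⟩ := hex
    rw [Finset.sum_eq_single_of_mem s' hs' fun b _ hb => hzero b fun hb' => hb (hb'.unique h)]
    exact hterm s' hs' h
  -- Without a possible entry nothing is earned; here `0 ≤ M` is used.
  · rw [Finset.sum_eq_zero fun s' hs' => hzero s' fun h => hex ⟨s', hs', h⟩]
    exact hM0

theorem exists_isGain_le (hJ : 1 ≤ J) (hA : ∀ a ∈ A, 0 ≤ a)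
    (hentry : ∀ a ∈ A, 0 < Θ.entryProb a) {M : ℝ} (hM0 : 0 ≤ M)
    (hM : ∀ a ∈ A, a * Θ.lam * Θ.entryProb a ≤ M) : ∃ g, Θ.IsGain π g ∧ g ≤ M := by
  obtain ⟨g, h, hh, hb⟩ := (Θ.generator π).exists_isBias (Θ.reachable_zero π hentry) (Θ.reward π)
  have hR := Θ.reward_nonneg π hA
  exact ⟨g, fun s₀ => (Θ.generator π).tendsto_lintegral_totalReward_div
    (Θ.exitRate_pos π hJ hentry) hR (hb.gain_nonneg hR) hh hb s₀,
    hb.gain_le (Θ.sum_Q_mul_reward_le π hM0 hM)⟩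

theorem IsGain.unique {Θ : TandemSystem J} {π : Θ.State → A} {g g' : ℝ} (h : Θ.IsGain π g)
    (h' : Θ.IsGain π g') : g = g' :=
  tendsto_nhds_unique (h 0).2 (h' 0).2

end TandemSystem

end

theorem proposition1 {J : ℕ} (hJ : 1 ≤ J) (Θ : TandemSystem J) (A : Set ℝ)
    (hA : ∀ a ∈ A, 0 ≤ a) (hentry : ∀ a ∈ A, 0 < Θ.entryProb a)
    (M : ℝ) (hM : IsGreatest ((fun a => a * Θ.lam * Θ.entryProb a) '' A) M) :
    (∀ π : Θ.State → A, ∃ g, Θ.IsGain π g ∧ g ≤ M) ∧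
      ∃ gopt, IsLUB {g | ∃ π : Θ.State → A, Θ.IsGain π g} gopt ∧ gopt ≤ M := by
  obtain ⟨⟨a₀, ha₀, hMa⟩, hMub⟩ := hM
  have hM0 : 0 ≤ M := hMa ▸
    mul_nonneg (mul_nonneg (hA a₀ ha₀) Θ.lam_pos.le) (hentry a₀ ha₀).le
  have hgain : ∀ π : Θ.State → A, ∃ g, Θ.IsGain π g ∧ g ≤ M := fun π =>
    Θ.exists_isGain_le π hJ hA hentry hM0 fun a ha => hMub ⟨a, ha, rfl⟩
  have hub : M ∈ upperBounds {g | ∃ π : Θ.State → A, Θ.IsGain π g} := by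
    rintro g ⟨π, hg⟩
    obtain ⟨g', hg', hle⟩ := hgain π
    exact (hg.unique hg').trans_le hle
  have hne : {g | ∃ π : Θ.State → A, Θ.IsGain π g}.Nonempty := by
    -- The price attaining `M`, quoted in every state, provides a policy.
    obtain ⟨g, hg, -⟩ := hgain fun _ => ⟨a₀, ha₀⟩
    exact ⟨g, _, hg⟩
  exact ⟨hgain, _, isLUB_csSup hne ⟨M, hub⟩, csSup_le hne hub⟩
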